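/- All matroids are finite, and $s,t$ denote integers exceeding one. A matroid $M$ is $(s,t)$-cyclic if there is a cyclic ordering $(e_1,e_2,\ldots,e_n)$ of its ground set such that, with subscripts modulo $n$: (i) $\{e_1,\ldots,e_s\}$ or $\{e_2,\ldots,e_{s+1}\}$ is an $s$-element circuit of $M$; (ii) $\{e_1,\ldots,e_t\}$ or $\{e_2,\ldots,e_{t+1}\}$ is a $t$-element cocircuit of $M$; (iii) for every $i$, if $\{e_i,\ldots,e_{i+s-1}\}$ is an $s$-element circuit of $M$, then so is $\{e_{i+2},\ldots,e_{i+s+1}\}$; (iv) for every $i$, if $\{e_i,\ldots,e_{i+t-1}\}$ is a $t$-element cocircuit of $M$, then so is $\{e_{i+2},\ldots,e_{i+t+1}\}$. For a positive even integer $n$, let $\Psi^n_s$ be the dual of the transversal matroid on $\{e_1,\ldots,e_n\}$ with presentation $(N(1),\ldots,N(n/2))$, where $N(i)=\{e_{2i-1},e_{2i},\ldots,e_{2i+s-2}\}$ with subscripts modulo $n$. The truncation $T(M)$ of a matroid $M$ of positive rank is obtained by freely adding an element $f$ to $M$ and then contracting $f$; if $r(M)=0$, then $T(M)=M$. Let $T^0(M)=M$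 and $T^i(M)=T(T^{i-1}(M))$. A matroid $M_2$ is a weak-map image of a matroid $M_1$ if there is a bijection $\varphi:E(M_1)\to E(M_2)$ such that $\varphi^{-1}(I)$ is independent in $M_1$ for every independent set $I$ of $M_2$. Theorem. Let $t\ge s\ge 2$ and let $M$ be an $(s,t)$-cyclic matroid on $n$ elements, where $n\ge s+t-1$. Then $n$ is even, $s\equiv t \pmod 2$, the matroid $T^{(t-s)/2}(\Psi^n_s)$ is $(s,t)$-cyclic, and $M$ is a weak-map image of $T^{(t-s)/2}(\Psi^n_s)$. -/

import Mathlib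

open Set

namespace CyclicMatroid

/-! ### Cyclic orderings and `(s, t)`-cyclic matroids -/

/-- The set `{e_i, e_{i+1}, …, e_{i+k-1}}` of `k` consecutive terms of `e`, where subscripts are
interpreted modulo `n`. -/
def consecutive {α : Type*} {n : ℕ} (e : ZMod n → α) (i : ZMod n) (k : ℕ) : Set α :=
  (fun j : ℕ => e (i + (j : ZMod n))) '' {j | j < k}

/-- `C` is a `k`-element circuit of `M`. -/
def IsCircuitOfSize {α : Type*} (M : Matroid α) (k : ℕ) (C : Set α) : Prop :=
  M.IsCircuit C ∧ C.ncard = k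

/-- `C` is a `k`-element cocircuit of `M`. -/
def IsCocircuitOfSize {α : Type*} (M : Matroid α) (k : ℕ) (C : Set α) : Prop :=
  M.IsCocircuit C ∧ C.ncard = k

/-- `e = (e_1, e_2, …, e_n)` is an `(s, t)`-cyclic ordering of the ground set of `M`. -/
structure IsCyclicOrdering {α : Type*} (M : Matroid α) (s t : ℕ) {n : ℕ} (e : ZMod n → α) :
    Prop where
  bijOn : BijOn e univ M.E
  circuit : IsCircuitOfSize M s (consecutive e 1 s) ∨ IsCircuitOfSize M s (consecutive e 2 s)
  cocircuit :
    IsCocircuitOfSize M t (consecutive e 1 t) ∨ IsCocircuitOfSize M t (consecutive e 2 t)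
  circuit_step : ∀ i : ZMod n,
    IsCircuitOfSize M s (consecutive e i s) → IsCircuitOfSize M s (consecutive e (i + 2) s)
  cocircuit_step : ∀ i : ZMod n,
    IsCocircuitOfSize M t (consecutive e i t) → IsCocircuitOfSize M t (consecutive e (i + 2) t)

/-- A (finite) matroid is `(s, t)`-cyclic if its ground set has an `(s, t)`-cyclic ordering. -/
def IsCyclic {α : Type*} (M : Matroid α) (s t : ℕ) : Prop :=
  ∃ n : ℕ, 0 < n ∧ ∃ e : ZMod n → α, IsCyclicOrdering M s t e

/-! ### Weak maps -/

/-- `φ` is a weak map from `M₁` to `M₂`: it is a bijection between the ground sets, and the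
inverse image of each independent set of `M₂` is independent in `M₁`. -/
def IsWeakMap {α β : Type*} (M₁ : Matroid α) (M₂ : Matroid β) (φ : α → β) : Prop :=
  BijOn φ M₁.E M₂.E ∧ ∀ I : Set β, M₂.Indep I → M₁.Indep (φ ⁻¹' I ∩ M₁.E)

/-- `M₂` is a weak-map image of `M₁`. -/
def IsWeakMapImage {α β : Type*} (M₂ : Matroid β) (M₁ : Matroid α) : Prop :=
  ∃ φ : α → β, IsWeakMap M₁ M₂ φ

/-! ### Transversal matroids -/

/-- `I` is a partial transversal of the family `A`: it can be matched into the index set. -/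
def IsPartialTransversal {α ι : Type*} (A : ι → Set α) (I : Set α) : Prop :=
  ∃ f : I → ι, Function.Injective f ∧ ∀ x : I, (x : α) ∈ A (f x)

theorem IsPartialTransversal.subset {α ι : Type*} {A : ι → Set α} {I J : Set α}
    (hJ : IsPartialTransversal A J) (hIJ : I ⊆ J) : IsPartialTransversal A I := by
  obtain ⟨f, hf, hfA⟩ := hJ
  exact ⟨fun x => f ⟨x, hIJ x.2⟩, fun x y h => Subtype.ext (congrArg (fun z : J => (z : α)) (hf h)),
    fun x => hfA ⟨x, hIJ x.2⟩⟩

theorem IsPartialTransversal.augment {α ι : Type*} [Finite α] {A : ι → Set α} {I J : Set α}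
    (hI : IsPartialTransversal A I) (hJ : IsPartialTransversal A J) (hlt : I.ncard < J.ncard) :
    ∃ x ∈ J, x ∉ I ∧ IsPartialTransversal A (insert x I) := by
  classical
  obtain ⟨g, hg, hgA⟩ := hJ
  -- among the matchings of `I`, choose one that agrees with `g` as often as possible
  have key : ∀ (k : ℕ) (f : I → ι), Function.Injective f → (∀ x : I, (x : α) ∈ A (f x)) →
      {x : I | ∃ h : (x : α) ∈ J, f x ≠ g ⟨x, h⟩}.ncard = k →
      ∃ x ∈ J, x ∉ I ∧ IsPartialTransversal A (insert x I) := by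
    intro k
    induction k using Nat.strong_induction_on with
    | _ k ih =>
      intro f hf hfA hk
      obtain ⟨y, hy⟩ : ∃ y : J, g y ∉ range f := by
        by_contra! hcon
        have hsub : range g ⊆ range f := by rintro _ ⟨y, rfl⟩; exact hcon y
        have h1 : (range g).ncard ≤ (range f).ncard := ncard_le_ncard hsub (toFinite _)
        rw [← image_univ, ← image_univ, ncard_image_of_injective _ hg,
          ncard_image_of_injective _ hf, ncard_univ, ncard_univ, Nat.card_coe_set_eq,
          Nat.card_coe_set_eq] at h1
        omega
      by_cases hyI : (y : α) ∈ I
      · have hne : ∀ z : I, f z ≠ g y := fun z h => hy ⟨z, h⟩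
        refine ih _ ?_ (Function.update f ⟨y, hyI⟩ (g y)) ?_ ?_ rfl
        · rw [← hk]
          apply ncard_lt_ncard _ (toFinite _)
          refine ⟨?_, ?_⟩
          · rintro x ⟨hxJ, hx⟩
            by_cases hxy : x = ⟨y, hyI⟩
            · subst hxy
              simp at hx
            · rw [Function.update_of_ne hxy] at hx
              exact ⟨hxJ, hx⟩
          · intro hcon
            obtain ⟨h, hx⟩ := hcon (show (⟨y, hyI⟩ : I) ∈ _ from ⟨y.2, hne _⟩)
            simp at hx
        · intro a b hab
          by_cases ha : a = ⟨y, hyI⟩ <;> by_cases hb : b = ⟨y, hyI⟩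
          · rw [ha, hb]
          · rw [ha, Function.update_self, Function.update_of_ne hb] at hab
            exact absurd hab.symm (hne b)
          · rw [hb, Function.update_self, Function.update_of_ne ha] at hab
            exact absurd hab (hne a)
          · rw [Function.update_of_ne ha, Function.update_of_ne hb] at hab
            exact hf hab
        · intro x
          by_cases hxy : x = ⟨y, hyI⟩
          · subst hxy
            simpa using hgA y
          · rw [Function.update_of_ne hxy]
            exact hfA x
      · refine ⟨y, y.2, hyI, fun x => if h : (x : α) ∈ I then f ⟨x, h⟩ else g y, ?_, ?_⟩
        · rintro ⟨a, ha⟩ ⟨b, hb⟩ hab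
          by_cases haI : a ∈ I <;> by_cases hbI : b ∈ I
          · simp only [haI, hbI, dif_pos] at hab
            simpa using hf hab
          · simp only [haI, hbI, dif_pos] at hab
            exact absurd ⟨_, hab⟩ hy
          · simp only [haI, hbI, dif_pos] at hab
            exact absurd ⟨_, hab.symm⟩ hy
          · have h1 := ha.resolve_right haI
            have h2 := hb.resolve_right hbI
            simp [h1, h2]
        · rintro ⟨a, ha⟩
          by_cases haI : a ∈ I
          · simpa [haI] using hfA ⟨a, haI⟩
          · have h1 := ha.resolve_right haI
            subst h1
            simpa [haI] using hgA y
  obtain ⟨f, hf, hfA⟩ := hI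
  exact key _ f hf hfA rfl

/-- The transversal matroid on the finite set `α` with presentation `A`. -/
def transversalMatroid {α ι : Type*} [Finite α] (A : ι → Set α) : Matroid α :=
  (IndepMatroid.ofFinite (E := univ) finite_univ (IsPartialTransversal A)
    ⟨fun x => x.2.elim, fun x => x.2.elim, fun x => x.2.elim⟩
    (fun _ _ hJ hIJ => hJ.subset hIJ)
    (fun _ _ hI hJ hlt => hI.augment hJ hlt)
    (fun _ _ => subset_univ _)).matroid

/-- The matroid `Ψ^n_s` on `{e_1, …, e_n}`, with `e_i` represented by `i : ZMod n`. It is the dual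
of the transversal matroid with presentation `(N(1), …, N(n/2))`, where
`N(i) = {e_{2i-1}, e_{2i}, …, e_{2i+s-2}}`; the index `i : Fin (n / 2)` below stands for the
number `i + 1` in `{1, …, n/2}`, so that the first subscript is `2(i + 1) - 1 = 2i + 1`. -/
def Psi (n s : ℕ) [NeZero n] : Matroid (ZMod n) :=
  (transversalMatroid fun i : Fin (n / 2) =>
    consecutive (fun x : ZMod n => x) ((2 * (i : ℕ) + 1 : ℕ) : ZMod n) s)✶

/-! ### Truncation -/

theorem preimage_some_encard_none_mem {α : Type*} {I : Set (Option α)} (h : none ∈ I) :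
    I.encard = (some ⁻¹' I : Set α).encard + 1 := by
  have h1 : I = insert none (some '' (some ⁻¹' I : Set α)) := by
    ext x; cases x <;> simp [h]
  conv_lhs => rw [h1]
  rw [encard_insert_of_notMem (by simp), (Option.some_injective α).encard_image]

theorem preimage_some_encard_none_notMem {α : Type*} {I : Set (Option α)} (h : none ∉ I) :
    I.encard = (some ⁻¹' I : Set α).encard := by
  have h1 : I = some '' (some ⁻¹' I : Set α) := by
    ext x; cases x <;> simp [h]
  conv_lhs => rw [h1]
  rw [(Option.some_injective α).encard_image]

/-- Independence in the free extension of `M` by a new element `f`, written `none`: a set not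
containing `f` is independent if it is independent in `M`, and `I ∪ {f}` is independent if `I` is
an independent set of `M` with `|I| < r(M)`. -/
def FreeExtIndep {α : Type*} (M : Matroid α) (I : Set (Option α)) : Prop :=
  M.Indep (some ⁻¹' I) ∧ (none ∈ I → (some ⁻¹' I : Set α).encard < M.eRank)

theorem FreeExtIndep.augment {α : Type*} [Finite α] {M : Matroid α} {I J : Set (Option α)}
    (hI : FreeExtIndep M I) (hJ : FreeExtIndep M J) (hlt : I.encard < J.encard) :
    ∃ x ∈ J, x ∉ I ∧ FreeExtIndep M (insert x I) := by
  have hJr : (some ⁻¹' J : Set α).encard ≤ M.eRank := hJ.1.encard_le_eRank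
  have hfinI : (some ⁻¹' I : Set α).encard ≠ ⊤ := (toFinite _).encard_lt_top.ne
  have hfinJ : (some ⁻¹' J : Set α).encard ≠ ⊤ := (toFinite _).encard_lt_top.ne
  -- an element of `J` other than `none` can be added
  have main : (some ⁻¹' I : Set α).encard < (some ⁻¹' J : Set α).encard →
      (none ∈ I → (some ⁻¹' I : Set α).encard + 1 < M.eRank) →
      ∃ x ∈ J, x ∉ I ∧ FreeExtIndep M (insert x I) := by
    intro h1 h2
    obtain ⟨y, ⟨hyJ, hyI⟩, hy⟩ := hI.1.augment hJ.1 h1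
    have h3 : (some ⁻¹' (insert (some y) I) : Set α) = insert y (some ⁻¹' I) := by
      ext z; simp
    refine ⟨some y, hyJ, hyI, by rwa [h3], fun h => ?_⟩
    rw [h3, encard_insert_of_notMem hyI]
    exact h2 (by simpa using h)
  by_cases hnI : none ∈ I <;> by_cases hnJ : none ∈ J
  · rw [preimage_some_encard_none_mem hnI, preimage_some_encard_none_mem hnJ] at hlt
    have h1 : (some ⁻¹' I : Set α).encard < (some ⁻¹' J : Set α).encard :=
      lt_of_add_lt_add_right hlt
    exact main h1 fun _ => lt_of_le_of_lt (Order.add_one_le_of_lt h1) (hJ.2 hnJ)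
  · rw [preimage_some_encard_none_mem hnI, preimage_some_encard_none_notMem hnJ] at hlt
    exact main (lt_of_le_of_lt le_self_add hlt) fun _ => lt_of_lt_of_le hlt hJr
  · rw [preimage_some_encard_none_notMem hnI, preimage_some_encard_none_mem hnJ] at hlt
    have h1 : (some ⁻¹' I : Set α).encard ≤ (some ⁻¹' J : Set α).encard :=
      Order.le_of_lt_add_one hlt
    have h3 : (some ⁻¹' (insert none I) : Set α) = some ⁻¹' I := by
      ext z; simp
    exact ⟨none, hnJ, hnI, by rw [h3]; exact hI.1,
      fun _ => by rw [h3]; exact lt_of_le_of_lt h1 (hJ.2 hnJ)⟩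
  · rw [preimage_some_encard_none_notMem hnI, preimage_some_encard_none_notMem hnJ] at hlt
    exact main hlt fun h => absurd h hnI

/-- The free extension of the matroid `M` by the new element `none`. -/
def freeExtension {α : Type*} [Finite α] (M : Matroid α) : Matroid (Option α) :=
  (IndepMatroid.ofBddAugment (insert none (some '' M.E)) (FreeExtIndep M)
    ⟨by simp, fun h => h.elim⟩
    (fun _ _ hJ hIJ => ⟨hJ.1.subset (preimage_mono hIJ),
      fun h => lt_of_le_of_lt (encard_le_encard (preimage_mono hIJ)) (hJ.2 (hIJ h))⟩)
    (fun _ _ hI hJ hlt => hI.augment hJ hlt)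
    ⟨Nat.card (Option α), fun I _ => by
      rw [← (toFinite I).cast_ncard_eq]
      exact_mod_cast ncard_le_card I⟩
    (fun I hI x hx => by
      cases x with
      | none => exact mem_insert _ _
      | some y => exact Or.inr ⟨y, hI.1.subset_ground hx, rfl⟩)).matroid

/-- The truncation `T(M)`: freely add an element `f` to `M` and then contract `f`. The result is
regarded as a matroid on `α` again. If `r(M) = 0`, then `f` is a loop of the free extension, and
contracting it gives back `M`. -/
def truncation {α : Type*} [Finite α] (M : Matroid α) : Matroid α :=
  ((freeExtension M).contract {none}).comap some

/-- The `i`-th truncation `T^i(M)`. -/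
def iterTruncation {α : Type*} [Finite α] : ℕ → Matroid α → Matroid α
  | 0, M => M
  | i + 1, M => truncation (iterTruncation i M)

end CyclicMatroid

/-! A circuit and a cocircuit never meet in exactly one element. Hence a circuit arc starting at `i`
forbids a cocircuit arc starting at `i + s - 1`, and dually. As both sets of starting points are
closed under adding 2, this forces `n` and `s + t` to be even. After a rotation, the circuit arcs
start at the odd positions and the cocircuit arcs at the positions of the parity of `s + 1`
(`even_and_shift_of_step_two`, `IsArcCyclic`).

The main tool is a nullity count (`ncard_add_card_le_of_isCircuit_arc`): circuit arcs that do not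
wrap past a cut point each contribute one to the nullity of a set containing them. In the complement
of a cocircuit arc this gives r(M) ≤ (n + s - t)/2, and the dual bound makes it an equality. For the
weak map, Hall's condition for a transversal of the `N(i)` avoiding an independent set `I` is the
same count, except when the union of the chosen `N(i)` is everything; then the rank bound and s ≤ t
suffice. Truncating (t - s)/2 times lowers the rank of `Ψ^n_s` from n/2 to r(M).

That the truncation is itself cyclic is deduced from `M`: the minimality of its circuits and
cocircuits is pulled back along the weak map, which preserves rank. -/

namespace CyclicMatroid

/-! ### Arcs of `ZMod n` -/

/-- The set `{i, i + 1, …, i + k - 1}` of `k` consecutive elements of `ZMod n`. -/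
def arc {n : ℕ} (i : ZMod n) (k : ℕ) : Set (ZMod n) :=
  consecutive (fun x : ZMod n => x) i k

section arc

variable {α : Type*} {n : ℕ}

theorem consecutive_eq_image_arc (e : ZMod n → α) (i : ZMod n) (k : ℕ) :
    consecutive e i k = e '' arc i k := by
  simp [consecutive, arc, image_image]

theorem add_natCast_mem_arc (i : ZMod n) {j k : ℕ} (h : j < k) : i + (j : ZMod n) ∈ arc i k :=
  ⟨j, h, rfl⟩

theorem mem_arc_iff [NeZero n] {i x : ZMod n} {k : ℕ} : x ∈ arc i k ↔ (x - i).val < k := by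
  constructor
  · rintro ⟨j, hj, rfl⟩
    simp only [mem_ofPred_eq] at hj
    simp only [add_sub_cancel_left, ZMod.val_natCast]
    exact (Nat.mod_le _ _).trans_lt hj
  · intro h
    have := add_natCast_mem_arc i h
    simpa using this

theorem ncard_arc [NeZero n] (i : ZMod n) {k : ℕ} (hk : k ≤ n) : (arc i k).ncard = k := by
  have hinj : InjOn (fun j : ℕ => i + (j : ZMod n)) {j | j < k} := by
    intro a ha b hb hab
    have ha' : a < n := lt_of_lt_of_le ha hk
    have hb' : b < n := lt_of_lt_of_le hb hk
    have h := congrArg ZMod.val (add_left_cancel hab)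
    rwa [ZMod.val_natCast_of_lt ha', ZMod.val_natCast_of_lt hb'] at h
  have h1 : (arc i k).ncard = ({j | j < k} : Set ℕ).ncard := hinj.ncard_image
  rw [h1]
  have h2 : ({j | j < k} : Set ℕ) = ((Finset.range k : Finset ℕ) : Set ℕ) := by ext; simp
  rw [h2, ncard_coe_finset, Finset.card_range]

theorem val_add_sub_natCast [NeZero n] (x : ZMod n) {t : ℕ} (ht : t ≤ n) :
    (t ≤ x.val → (x - t).val = x.val - t) ∧ (x.val < t → (x - t).val = x.val + n - t) := by
  have hx := x.val_lt
  constructor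
  · intro h
    have h1 : x - (t : ZMod n) = ((x.val - t : ℕ) : ZMod n) := by
      rw [Nat.cast_sub h]; simp
    rw [h1, ZMod.val_natCast_of_lt (by omega)]
  · intro h
    have h1 : x - (t : ZMod n) = ((x.val + n - t : ℕ) : ZMod n) := by
      rw [Nat.cast_sub (by omega)]; simp
    rw [h1, ZMod.val_natCast_of_lt (by omega)]

theorem compl_arc [NeZero n] (b : ZMod n) {t : ℕ} (ht : t ≤ n) :
    (arc b t)ᶜ = arc (b + (t : ZMod n)) (n - t) := by
  ext x
  obtain ⟨h1, h2⟩ := val_add_sub_natCast (x - b) ht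
  have hlt := (x - b).val_lt
  rw [mem_compl_iff, mem_arc_iff, mem_arc_iff, ← sub_sub]
  by_cases h : t ≤ (x - b).val
  · rw [h1 h]; omega
  · rw [h2 (by omega)]; omega

theorem arc_add_subset (c : ZMod n) {k s m : ℕ} (h : k + s ≤ m) :
    arc (c + (k : ZMod n)) s ⊆ arc c m := by
  rintro _ ⟨j, hj, rfl⟩
  simp only [mem_ofPred_eq] at hj
  have := add_natCast_mem_arc c (show k + j < m by omega)
  simpa [add_assoc] using this

end arc

/-! ### Circuits with private elements -/

section circuits

variable {α ι : Type*} {M : Matroid α}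

/-- If `X` contains circuits `C i`, ordered by `k`, each with an element `l i` that is in none of
the preceding circuits, then the nullity of `X` is at least the number of these circuits. -/
theorem ncard_add_card_le_of_isCircuit {X I : Set α} (hX : X.Finite) (hXE : X ⊆ M.E)
    (hI : M.Indep I) (hIX : I ⊆ X) (J : Finset ι) (C : ι → Set α) (l : ι → α) (k : ι → ℕ)
    (hC : ∀ i ∈ J, M.IsCircuit (C i)) (hCX : ∀ i ∈ J, C i ⊆ X) (hl : ∀ i ∈ J, l i ∈ C i)
    (hsep : ∀ i ∈ J, ∀ j ∈ J, i ≠ j → k i ≤ k j → l j ∉ C i) :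
    I.ncard + J.card ≤ X.ncard := by
  classical
  have hlinj : InjOn l (J : Set ι) := by
    intro i hi j hj hij
    by_contra hne
    rcases le_total (k i) (k j) with h | h
    · exact hsep i hi j hj hne h (hij ▸ hl i hi)
    · exact hsep j hj i hi (Ne.symm hne) h (hij ▸ hl j hj)
  set L : Set α := l '' (J : Set ι) with hL
  have hLX : L ⊆ X := by
    rintro _ ⟨i, hi, rfl⟩
    exact hCX i hi (hl i hi)
  have hLcard : L.ncard = J.card := by
    rw [hL, hlinj.ncard_image, ncard_coe_finset]
  -- Any other deleted element of `C i` has a smaller value of `k`, so by induction it is already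
  -- spanned; then `C i` puts `l i` in the closure as well. Thus `X \ L` spans `X`.
  have key : ∀ m : ℕ, ∀ i ∈ J, k i = m → l i ∈ M.closure (X \ L) := by
    intro m
    induction m using Nat.strong_induction_on with
    | _ m ih =>
      intro i hi him
      refine M.closure_subset_closure_of_subset_closure ?_
        ((hC i hi).mem_closure_sdiff_singleton_of_mem (hl i hi))
      rintro x ⟨hxC, hxl⟩
      by_cases hxL : x ∈ L
      · obtain ⟨j, hj, rfl⟩ := hxL
        have hne : i ≠ j := by rintro rfl; exact hxl rfl
        have hlt : k j < k i := by
          by_contra h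
          exact hsep i hi j hj hne (not_lt.1 h) hxC
        exact ih _ (him ▸ hlt) j hj rfl
      · exact M.mem_closure_of_mem' ⟨hCX i hi hxC, hxL⟩ (hXE (hCX i hi hxC))
  have hcl : X ⊆ M.closure (X \ L) := by
    intro x hx
    by_cases hxL : x ∈ L
    · obtain ⟨j, hj, rfl⟩ := hxL
      exact key _ j hj rfl
    · exact M.mem_closure_of_mem' ⟨hx, hxL⟩ (hXE hx)
  have h1 : I.encard ≤ (X \ L).encard :=
    calc I.encard ≤ M.eRk (M.closure (X \ L)) := hI.encard_le_eRk_of_subset (hIX.trans hcl)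
      _ = M.eRk (X \ L) := M.eRk_closure_eq _
      _ ≤ (X \ L).encard := M.eRk_le_encard _
  have h2 : I.ncard ≤ (X \ L).ncard := by
    rw [← (hX.subset hIX).cast_ncard_eq, ← (hX.sdiff (t := L)).cast_ncard_eq] at h1
    exact_mod_cast h1
  have h3 := ncard_sdiff_add_ncard_of_subset hLX hX
  omega

variable {n : ℕ} {e : ZMod n → α} {s t : ℕ}

theorem image_subset_ground (he : BijOn e univ M.E) (X : Set (ZMod n)) : e '' X ⊆ M.E :=
  (image_mono (subset_univ X)).trans he.image_eq.subset

theorem ground_sdiff_image (he : BijOn e univ M.E) (X : Set (ZMod n)) :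
    M.E \ e '' X = e '' Xᶜ := by
  rw [compl_eq_univ_sdiff, image_sdiff (injOn_univ.1 he.injOn), he.image_eq]

variable [NeZero n]

theorem ncard_image_arc (he : BijOn e univ M.E) (i : ZMod n) {k : ℕ} (hk : k ≤ n) :
    (e '' arc i k).ncard = k := by
  rw [ncard_image_of_injective _ (injOn_univ.1 he.injOn), ncard_arc i hk]

/-- Distinct circuits that are arcs and do not run past the end of the ordering starting at `c`
contribute one each to the nullity. -/
theorem ncard_add_card_le_of_isCircuit_arc (he : BijOn e univ M.E) (hs : 1 ≤ s)
    {X : Set (ZMod n)} {I : Set α} (hI : M.Indep I) (hIX : I ⊆ e '' X) (J : Finset ι)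
    (c : ZMod n) (k : ι → ℕ) (hk : InjOn k J) (hkn : ∀ i ∈ J, k i + s ≤ n)
    (hC : ∀ i ∈ J, M.IsCircuit (e '' arc (c + (k i : ZMod n)) s)) (hX : ∀ i ∈ J, arc (c + (k i : ZMod n)) s ⊆ X) :
    I.ncard + J.card ≤ X.ncard := by
  have hinj := injOn_univ.1 he.injOn
  rw [← ncard_image_of_injective X hinj]
  -- The private element of each arc is its last one; `hkn` prevents wrapping, so an arc starting
  -- earlier cannot reach it.
  refine ncard_add_card_le_of_isCircuit (toFinite _) (image_subset_ground he X) hI hIX J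
    (fun i => e '' arc (c + (k i : ZMod n)) s) (fun i => e (c + (k i : ZMod n) + ((s - 1 : ℕ) : ZMod n))) k hC
    (fun i hi => image_mono (hX i hi))
    (fun i _ => mem_image_of_mem _ (add_natCast_mem_arc _ (by omega))) ?_
  intro i hi j hj hij hle
  have hne : k i ≠ k j := fun h => hij (hk hi hj h)
  have h1 := hkn i hi
  have h2 := hkn j hj
  rw [hinj.mem_set_image, mem_arc_iff]
  have h3 : c + k j + ((s - 1 : ℕ) : ZMod n) - (c + k i) = ((k j + (s - 1) - k i : ℕ) : ZMod n) := by
    rw [Nat.cast_sub (by omega : k i ≤ k j + (s - 1)), Nat.cast_add]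
    ring
  rw [h3, ZMod.val_natCast_of_lt (by omega)]
  omega

/-- The arc contains the circuits starting at `c`, `c + 2`, …, which are `(n - s - t) / 2 + 1` in
number. The bound allows for the floor; when `n + s + t` is even, parity improves it by one. -/
theorem ncard_of_subset_compl_cocircuit (he : BijOn e univ M.E) (hs : 1 ≤ s) (hst : s + t ≤ n)
    (c : ZMod n) (hC : ∀ m : ℕ, M.IsCircuit (e '' arc (c + ((2 * m : ℕ) : ZMod n)) s)) {I : Set α}
    (hI : M.Indep I) (hIX : I ⊆ e '' arc c (n - t)) : 2 * I.ncard + t + 1 ≤ n + s := by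
  have h := ncard_add_card_le_of_isCircuit_arc he hs hI hIX
    (Finset.range ((n - s - t) / 2 + 1)) c (fun m => 2 * m)
    (fun a _ b _ h => by simpa using h)
    (fun i hi => by rw [Finset.mem_range] at hi; omega)
    (fun i _ => hC i)
    (fun i hi => arc_add_subset c (by rw [Finset.mem_range] at hi; omega))
  rw [Finset.card_range, ncard_arc _ (by omega)] at h
  omega

/-- A hyperplane which is an arc containing many circuits bounds the rank. -/
theorem ncard_le_of_isCocircuit (he : BijOn e univ M.E) (hs : 1 ≤ s) (ht : 1 ≤ t)
    (hst : s + t ≤ n) (hpar : Even (n + s + t)) (b : ZMod n) (hK : M.IsCocircuit (e '' arc b t))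
    (hC : ∀ m : ℕ, M.IsCircuit (e '' arc (b + (t : ZMod n) + ((2 * m : ℕ) : ZMod n)) s)) {I : Set α}
    (hI : M.Indep I) : 2 * I.ncard + t ≤ n + s := by
  have hfin : M.E.Finite := he.image_eq ▸ toFinite _
  have hb : e b ∈ e '' arc b t := by
    have := add_natCast_mem_arc b (show 0 < t by omega)
    exact mem_image_of_mem e (by simpa using this)
  -- Deleting one element from the cocircuit leaves a coindependent set, so the complementary arc
  -- together with `e b` spans `M`, and the rank exceeds that of the arc by at most one.
  have hco : M.Coindep (e '' arc b t \ {e b}) := hK.isCircuit.sdiff_singleton_indep hb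
  have hsp := hco.compl_spanning
  have hset : M.E \ (e '' arc b t \ {e b}) = insert (e b) (e '' arc (b + (t : ZMod n)) (n - t)) := by
    rw [← compl_arc b (by omega), ← ground_sdiff_image he]
    have : e b ∈ M.E := image_subset_ground he _ hb
    ext x
    by_cases hx : x = e b
    · subst hx; simp [this]
    · simp [hx]
  obtain ⟨J, hJ⟩ := M.exists_isBasis (e '' arc (b + (t : ZMod n)) (n - t)) (image_subset_ground he _)
  have h1 : I.encard ≤ J.encard + 1 :=
    calc I.encard ≤ M.eRank := hI.encard_le_eRank
      _ = M.eRk (insert (e b) (e '' arc (b + (t : ZMod n)) (n - t))) := by rw [← hset, hsp.eRk_eq]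
      _ ≤ M.eRk (e '' arc (b + (t : ZMod n)) (n - t)) + 1 := M.eRk_insert_le_add_one _ _
      _ = J.encard + 1 := by rw [hJ.encard_eq_eRk]
  rw [← (hfin.subset hI.subset_ground).cast_ncard_eq,
    ← (hfin.subset hJ.indep.subset_ground).cast_ncard_eq] at h1
  have h2 : I.ncard ≤ J.ncard + 1 := by exact_mod_cast h1
  have h3 := ncard_of_subset_compl_cocircuit he hs hst (b + t) hC hJ.indep hJ.subset
  obtain ⟨p, hp⟩ := hpar
  omega

/-- Orthogonality: `s + t ≤ n + 1` keeps the second arc from wrapping round to the start of the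
first, so they share only the last element of the first. -/
theorem not_isCocircuit_of_isCircuit (he : BijOn e univ M.E) (hs : 1 ≤ s) (ht : 1 ≤ t)
    (hst : s + t ≤ n + 1) (i : ZMod n) (hC : M.IsCircuit (e '' arc i s)) :
    ¬ M.IsCocircuit (e '' arc (i + ((s - 1 : ℕ) : ZMod n)) t) := by
  intro hK
  have hinj := injOn_univ.1 he.injOn
  have h1 : arc i s ∩ arc (i + ((s - 1 : ℕ) : ZMod n)) t = {i + ((s - 1 : ℕ) : ZMod n)} := by
    ext x
    simp only [mem_inter_iff, mem_arc_iff, ← sub_sub, mem_singleton_iff]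
    obtain ⟨h1, h2⟩ := val_add_sub_natCast (x - i) (show s - 1 ≤ n by omega)
    have hlt := (x - i).val_lt
    constructor
    · rintro ⟨h3, h4⟩
      have h5 : (x - i).val = s - 1 := by
        by_contra hne
        rw [h2 (by omega)] at h4
        omega
      rw [← h5]
      simp
    · rintro rfl
      simp only [add_sub_cancel_left, sub_self, ZMod.val_zero]
      rw [ZMod.val_natCast_of_lt (by omega)]
      omega
  have h2 : (e '' arc i s ∩ e '' arc (i + ((s - 1 : ℕ) : ZMod n)) t) = {e (i + ((s - 1 : ℕ) : ZMod n))} := by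
    rw [← image_inter hinj, h1, image_singleton]
  have h3 := hC.isCocircuit_inter_nontrivial hK (by rw [h2]; exact singleton_nonempty _)
  rw [h2] at h3
  exact not_nontrivial_singleton h3

end circuits

/-! ### Transversal matroids with a full transversal -/

section transversal

variable {α ι : Type*} {A : ι → Set α}

theorem isPartialTransversal_range {f : ι → α} (hf : Function.Injective f)
    (hfA : ∀ i, f i ∈ A i) : IsPartialTransversal A (range f) := by
  refine ⟨fun x => (Equiv.ofInjective f hf).symm x, (Equiv.injective _), fun x => ?_⟩
  have := hfA ((Equiv.ofInjective f hf).symm x)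
  rwa [Equiv.apply_ofInjective_symm hf] at this

theorem IsPartialTransversal.ncard_le [Finite ι] {I : Set α} (h : IsPartialTransversal A I) :
    I.ncard ≤ Nat.card ι := by
  obtain ⟨f, hf, -⟩ := h
  rw [← Nat.card_coe_set_eq]
  exact Nat.card_le_card_of_injective f hf

variable [Finite α]

theorem transversalMatroid_indep_iff {I : Set α} :
    (transversalMatroid A).Indep I ↔ IsPartialTransversal A I := Iff.rfl

theorem transversalMatroid_ground : (transversalMatroid A).E = univ := rfl

variable [Finite ι]

theorem isBase_range_transversalMatroid {f : ι → α} (hf : Function.Injective f)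
    (hfA : ∀ i, f i ∈ A i) : (transversalMatroid A).IsBase (range f) := by
  refine (transversalMatroid_indep_iff.2 (isPartialTransversal_range hf hfA)).isBase_of_maximal ?_
  intro J hJ hIJ
  refine eq_of_subset_of_ncard_le hIJ ?_ (toFinite _)
  rw [← image_univ, ncard_image_of_injective _ hf, ncard_univ]
  exact (transversalMatroid_indep_iff.1 hJ).ncard_le

theorem exists_transversal_of_isBase {f₀ : ι → α} (hf₀ : Function.Injective f₀)
    (hf₀A : ∀ i, f₀ i ∈ A i) {B : Set α} (hB : (transversalMatroid A).IsBase B) :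
    ∃ f : ι → α, Function.Injective f ∧ ∀ i, f i ∈ A i ∧ f i ∈ B := by
  have hcard : Nat.card B = Nat.card ι := by
    rw [Nat.card_coe_set_eq, hB.ncard_eq_ncard_of_isBase (isBase_range_transversalMatroid hf₀ hf₀A),
      ← image_univ, ncard_image_of_injective _ hf₀, ncard_univ]
  obtain ⟨g, hg, hgA⟩ := transversalMatroid_indep_iff.1 hB.indep
  have hbij : Function.Bijective g := (Nat.bijective_iff_injective_and_card g).2 ⟨hg, hcard⟩
  let σ := Equiv.ofBijective g hbij
  refine ⟨fun i => σ.symm i, Subtype.val_injective.comp σ.symm.injective, fun i => ⟨?_, (σ.symm i).2⟩⟩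
  have h1 := hgA (σ.symm i)
  have h2 : g (σ.symm i) = i := σ.apply_symm_apply i
  rwa [h2] at h1

/-- Since a full transversal `f₀` exists, the bases are exactly the full transversals, and a set is
coindependent when one of them avoids it. This form is suited to Hall's theorem. -/
theorem dual_transversalMatroid_indep_iff {f₀ : ι → α} (hf₀ : Function.Injective f₀)
    (hf₀A : ∀ i, f₀ i ∈ A i) {I : Set α} :
    (transversalMatroid A)✶.Indep I ↔
      ∃ f : ι → α, Function.Injective f ∧ ∀ i, f i ∈ A i ∧ f i ∉ I := by
  rw [Matroid.dual_indep_iff_exists (subset_univ I)]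
  constructor
  · rintro ⟨B, hB, hdisj⟩
    obtain ⟨f, hf, hfB⟩ := exists_transversal_of_isBase hf₀ hf₀A hB
    exact ⟨f, hf, fun i => ⟨(hfB i).1, fun h => disjoint_left.1 hdisj h (hfB i).2⟩⟩
  · rintro ⟨f, hf, hfA⟩
    refine ⟨range f, isBase_range_transversalMatroid hf fun i => (hfA i).1, ?_⟩
    rw [disjoint_right]
    rintro _ ⟨i, rfl⟩
    exact (hfA i).2

end transversal

/-! ### The matroid `Ψ^n_s` -/

section Psi

variable {n s : ℕ}

theorem natCast_two_mul_add_one_injective [NeZero n] :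
    Function.Injective fun i : Fin (n / 2) => ((2 * (i : ℕ) + 1 : ℕ) : ZMod n) := by
  intro i j hij
  have h := congrArg ZMod.val hij
  have hi := i.2
  have hj := j.2
  simp only at h
  rw [ZMod.val_natCast_of_lt (by omega), ZMod.val_natCast_of_lt (by omega)] at h
  exact Fin.ext (by omega)

theorem self_mem_arc (hs : 1 ≤ s) (i : ZMod n) : i ∈ arc i s := by
  simpa using add_natCast_mem_arc i (show 0 < s by omega)

theorem Psi_indep_iff [NeZero n] (hs : 1 ≤ s) {I : Set (ZMod n)} :
    (Psi n s).Indep I ↔ ∃ f : Fin (n / 2) → ZMod n, Function.Injective f ∧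
      ∀ i : Fin (n / 2), f i ∈ arc ((2 * (i : ℕ) + 1 : ℕ) : ZMod n) s ∧ f i ∉ I :=
  dual_transversalMatroid_indep_iff natCast_two_mul_add_one_injective
    fun _ => self_mem_arc hs _

theorem Psi_ground [NeZero n] : (Psi n s).E = univ := rfl

theorem eRank_Psi [NeZero n] (hs : 1 ≤ s) (hn : Even n) : (Psi n s).eRank = (n / 2 : ℕ) := by
  have hB := (isBase_range_transversalMatroid
    (natCast_two_mul_add_one_injective (n := n)) fun i => self_mem_arc hs _).compl_isBase_dual
  have h : (Psi n s).eRank = _ := hB.encard_eq_eRank.symm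
  rw [h, transversalMatroid_ground, ← compl_eq_univ_sdiff, ← (toFinite _).cast_ncard_eq, ncard_compl,
    ← image_univ, ncard_image_of_injective _ natCast_two_mul_add_one_injective, ncard_univ,
    Nat.card_zmod, Nat.card_fin]
  obtain ⟨p, hp⟩ := hn
  congr 1
  omega

end Psi

/-! ### Truncations -/

section truncation

variable {α : Type*} [Finite α] {M : Matroid α}

theorem freeExtension_indep_iff {I : Set (Option α)} :
    (freeExtension M).Indep I ↔ FreeExtIndep M I := Iff.rfl

/-- Positive rank makes the added element a nonloop, so independence after contracting it is
independence together with it in the free extension. -/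
theorem truncation_indep_iff {r : ℕ} (hM : M.eRank = (r + 1 : ℕ)) {I : Set α} :
    (truncation M).Indep I ↔ M.Indep I ∧ I.encard ≤ r := by
  have hnone : (freeExtension M).Indep {none} := by
    rw [freeExtension_indep_iff]
    have h : (some ⁻¹' ({none} : Set (Option α)) : Set α) = ∅ := by ext; simp
    refine ⟨by rw [h]; exact M.empty_indep, fun _ => ?_⟩
    rw [h, hM, encard_empty]
    exact_mod_cast Nat.succ_pos r
  rw [truncation, Matroid.comap_indep_iff, hnone.contract_indep_iff, freeExtension_indep_iff,
    FreeExtIndep]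
  have h : (some ⁻¹' (some '' I ∪ {none}) : Set α) = I := by ext; simp
  rw [h, hM]
  have h2 : I.encard < (r + 1 : ℕ) ↔ I.encard ≤ r := by
    rw [Nat.cast_add, Nat.cast_one, ENat.lt_natCast_add_one_iff]
  simp only [h2, mem_union, mem_singleton_iff, or_true, forall_const]
  simp [(Option.some_injective α).injOn]

theorem truncation_ground : (truncation M).E = M.E := by
  ext x
  have h : (freeExtension M).E = insert none (some '' M.E) := rfl
  simp [truncation, h]

theorem eRank_truncation {r : ℕ} (hM : M.eRank = (r + 1 : ℕ)) : (truncation M).eRank = r := by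
  obtain ⟨B, hB⟩ := (truncation M).exists_isBase
  refine le_antisymm ?_ ?_
  · rw [← hB.encard_eq_eRank]
    exact ((truncation_indep_iff hM).1 hB.indep).2
  · obtain ⟨B', hB'⟩ := M.exists_isBase
    have hr : (r : ℕ∞) ≤ B'.encard := by
      rw [hB'.encard_eq_eRank, hM]
      exact_mod_cast Nat.le_succ r
    obtain ⟨I, hIB, hI⟩ := exists_subset_encard_eq hr
    rw [← hI]
    exact ((truncation_indep_iff hM).2 ⟨hB'.indep.subset hIB, hI.le⟩).encard_le_eRank

theorem eRank_iterTruncation {k r : ℕ} (hM : M.eRank = (r + k : ℕ)) :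
    (iterTruncation k M).eRank = r := by
  induction k generalizing r with
  | zero => simpa [iterTruncation] using hM
  | succ k ih =>
    exact eRank_truncation (ih (r := r + 1) (by rw [hM]; congr 1; omega))

theorem iterTruncation_indep_iff {k r : ℕ} (hM : M.eRank = (r + k : ℕ)) {I : Set α} :
    (iterTruncation k M).Indep I ↔ M.Indep I ∧ I.encard ≤ r := by
  induction k generalizing r with
  | zero =>
    have : M.Indep I → I.encard ≤ r := fun h => by simpa [hM] using h.encard_le_eRank
    simpa [iterTruncation] using this
  | succ k ih =>
    have h : M.eRank = (r + 1 + k : ℕ) := by rw [hM]; congr 1; omega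
    rw [iterTruncation, truncation_indep_iff (eRank_iterTruncation h), ih h, and_assoc]
    refine and_congr_right fun _ => ⟨fun h => h.2, fun h => ⟨h.trans ?_, h⟩⟩
    exact_mod_cast Nat.le_succ r

theorem iterTruncation_ground (k : ℕ) : (iterTruncation k M).E = M.E := by
  induction k with
  | zero => rfl
  | succ k ih => rw [iterTruncation, truncation_ground, ih]

end truncation

/-! ### Normal form of a cyclic ordering -/

section normalForm

variable {α : Type*} {M : Matroid α} {n s t : ℕ} {e : ZMod n → α}

/-- A normal form of an `(s, t)`-cyclic ordering: the arcs of length `s` that start at an odd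
position are circuits, and the arcs of length `t` that start at a position with the parity of
`s + 1` are cocircuits. -/
structure IsArcCyclic (M : Matroid α) (s t : ℕ) (e : ZMod n → α) : Prop where
  bijOn : BijOn e univ M.E
  circuit : ∀ m : ℕ, M.IsCircuit (e '' arc (1 + ((2 * m : ℕ) : ZMod n)) s)
  cocircuit : ∀ m : ℕ, M.IsCocircuit (e '' arc ((s : ZMod n) + 1 + ((2 * m : ℕ) : ZMod n)) t)

theorem isCircuitOfSize_iff [NeZero n] (he : BijOn e univ M.E) {k : ℕ} (hk : k ≤ n) (i : ZMod n) :
    IsCircuitOfSize M k (consecutive e i k) ↔ M.IsCircuit (e '' arc i k) := by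
  rw [IsCircuitOfSize, consecutive_eq_image_arc, ncard_image_arc he i hk, and_iff_left rfl]

theorem isCocircuitOfSize_iff [NeZero n] (he : BijOn e univ M.E) {k : ℕ} (hk : k ≤ n)
    (i : ZMod n) :
    IsCocircuitOfSize M k (consecutive e i k) ↔ M.IsCocircuit (e '' arc i k) := by
  rw [IsCocircuitOfSize, consecutive_eq_image_arc, ncard_image_arc he i hk, and_iff_left rfl]

theorem not_isCircuit_of_isCocircuit [NeZero n] (he : BijOn e univ M.E) (hs : 1 ≤ s) (ht : 1 ≤ t)
    (hst : s + t ≤ n + 1) (i : ZMod n) (hK : M.IsCocircuit (e '' arc i t)) :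
    ¬ M.IsCircuit (e '' arc (i + ((t - 1 : ℕ) : ZMod n)) s) := by
  rw [← M.dual_isCocircuit_iff]
  exact not_isCocircuit_of_isCircuit (M := M✶) he ht hs (by omega) i hK

theorem image_arc_add_right (e : ZMod n → α) (c i : ZMod n) (k : ℕ) :
    (fun x => e (x + c)) '' arc i k = e '' arc (i + c) k := by
  simp only [← consecutive_eq_image_arc]
  simp only [consecutive, add_right_comm]

/-- If `A` and `B` are nonempty, closed under adding `2`, and orthogonal as the positions of
`s`-element circuits and `t`-element cocircuits are, then `n` and `s + t` are even, and the
positions in `A` determine those in `B`. -/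
theorem even_and_shift_of_step_two [NeZero n] {A B : ZMod n → Prop} (hA : ∀ i, A i → A (i + 2))
    (hB : ∀ i, B i → B (i + 2)) (hAB : ∀ i, A i → ¬ B (i + ((s - 1 : ℕ) : ZMod n)))
    (hBA : ∀ i, B i → ¬ A (i + ((t - 1 : ℕ) : ZMod n))) (hs : 1 ≤ s) (ht : 1 ≤ t)
    {i j : ZMod n} (hi : A i) (hj : B j) :
    Even n ∧ Even (s + t) ∧ ∀ m : ℕ, A (i + ((2 * m : ℕ) : ZMod n)) ∧
      B (i + (s : ZMod n) + ((2 * m : ℕ) : ZMod n)) := by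
  have hA' : ∀ m : ℕ, A (i + ((2 * m : ℕ) : ZMod n)) := by
    intro m
    induction m with
    | zero => simpa using hi
    | succ m ih =>
      have := hA _ ih
      rw [add_assoc] at this
      exact_mod_cast this
  have hB' : ∀ m : ℕ, B (j + ((2 * m : ℕ) : ZMod n)) := by
    intro m
    induction m with
    | zero => simpa using hj
    | succ m ih =>
      have := hB _ ih
      rw [add_assoc] at this
      exact_mod_cast this
  set d := (i + ((s - 1 : ℕ) : ZMod n) - j).val with hd
  set d' := (j + ((t - 1 : ℕ) : ZMod n) - i).val with hd'
  have hjd : j + (d : ZMod n) = i + ((s - 1 : ℕ) : ZMod n) := by simp [hd]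
  have hid : i + (d' : ZMod n) = j + ((t - 1 : ℕ) : ZMod n) := by simp [hd']
  -- `d + q * n` steps from `j` lead to the forbidden position `i + s - 1`, so this number is odd
  -- for every `q`; `q = 0` and `q = 1` force `n` to be even.
  have hdodd : ∀ q : ℕ, ¬ Even (d + q * n) := by
    rintro q ⟨m, hm⟩
    refine hAB i hi ?_
    have h := hB' m
    rw [two_mul, ← hm] at h
    simpa [hjd] using h
  have hdodd' : ∀ q : ℕ, ¬ Even (d' + q * n) := by
    rintro q ⟨m, hm⟩
    refine hBA j hj ?_
    have h := hA' m
    rw [two_mul, ← hm] at h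
    simpa [hid] using h
  have h0 := hdodd 0
  have h1 := hdodd 1
  have h0' := hdodd' 0
  simp only [Nat.even_iff] at h0 h1 h0'
  have hn : n % 2 = 0 := by omega
  -- Since `n` is even, this congruence also holds modulo 2; `d` and `d'` are odd, so `s + t` is
  -- even.
  have hsum : ((d + d' : ℕ) : ZMod n) = ((s + t - 2 : ℕ) : ZMod n) := by
    have h2 : s + t - 2 = (s - 1) + (t - 1) := by omega
    rw [h2]
    push_cast
    linear_combination hjd + hid
  have hmod : (d + d') % 2 = (s + t - 2) % 2 := by
    have h3 := (ZMod.natCast_eq_natCast_iff _ _ _).1 hsum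
    exact h3.of_dvd (Nat.dvd_of_mod_eq_zero hn)
  refine ⟨Nat.even_iff.2 hn, Nat.even_iff.2 (by omega), fun m => ⟨hA' m, ?_⟩⟩
  -- The position `i + s` is `d + 1` steps from `j`, an even number.
  have h4 := hB' ((d + 1) / 2 + m)
  have h5 : 2 * ((d + 1) / 2 + m) = d + 1 + 2 * m := by omega
  have h6 : ((s - 1 : ℕ) : ZMod n) + 1 = s := by
    rw [← Nat.cast_add_one]; congr 1; omega
  rw [h5, Nat.cast_add, Nat.cast_add, ← add_assoc, ← add_assoc, hjd, Nat.cast_one,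
    add_assoc i, h6] at h4
  exact h4

theorem IsCyclicOrdering.exists_isArcCyclic [NeZero n] (h : IsCyclicOrdering M s t e)
    (hs : 1 ≤ s) (ht : 1 ≤ t) (hst : s + t ≤ n + 1) :
    Even n ∧ Even (s + t) ∧ ∃ e' : ZMod n → α, IsArcCyclic M s t e' := by
  have he := h.bijOn
  have h1 := h.circuit
  have h2 := h.cocircuit
  have h3 := h.circuit_step
  have h4 := h.cocircuit_step
  simp only [isCircuitOfSize_iff he (show s ≤ n by omega)] at h1 h3
  simp only [isCocircuitOfSize_iff he (show t ≤ n by omega)] at h2 h4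
  obtain ⟨i, hi⟩ : ∃ i, M.IsCircuit (e '' arc i s) := h1.elim (fun h => ⟨_, h⟩) (fun h => ⟨_, h⟩)
  obtain ⟨j, hj⟩ : ∃ j, M.IsCocircuit (e '' arc j t) := h2.elim (fun h => ⟨_, h⟩) (fun h => ⟨_, h⟩)
  obtain ⟨hn, hpar, hm⟩ := even_and_shift_of_step_two (A := fun i => M.IsCircuit (e '' arc i s))
    (B := fun j => M.IsCocircuit (e '' arc j t)) h3 h4
    (fun i hi => not_isCocircuit_of_isCircuit he hs ht hst i hi)
    (fun j hj => not_isCircuit_of_isCocircuit he hs ht hst j hj) hs ht hi hj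
  refine ⟨hn, hpar, fun x => e (x + (i - 1)), ?_, fun m => ?_, fun m => ?_⟩
  · exact he.comp ((Equiv.addRight (i - 1)).bijective.bijOn_univ)
  · rw [image_arc_add_right]
    convert (hm m).1 using 3
    ring
  · rw [image_arc_add_right]
    convert (hm m).2 using 3
    ring

variable [NeZero n]

/-- The step conditions range over all positions. At those of the wrong parity they are vacuous,
because orthogonality with the known arcs rules out a circuit or cocircuit there. -/
theorem IsArcCyclic.isCyclic (h : IsArcCyclic M s t e) (hs : 1 ≤ s) (ht : 1 ≤ t) (hn : Even n)
    (hpar : Even (s + t)) (hst : s + t ≤ n + 1) : IsCyclic M s t := by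
  have he := h.bijOn
  obtain ⟨p, hp⟩ := hn
  obtain ⟨q, hq⟩ := hpar
  have hval : ∀ x : ZMod n, ((x.val : ℕ) : ZMod n) = x := fun x => by simp
  have hn0 : (n : ZMod n) = 0 := by simp
  refine ⟨n, NeZero.pos n, e, he, Or.inl ?_, ?_, fun i => ?_, fun j => ?_⟩
  · rw [isCircuitOfSize_iff he (by omega)]
    simpa using h.circuit 0
  · simp only [isCocircuitOfSize_iff he (show t ≤ n by omega)]
    rcases Nat.even_or_odd s with ⟨a, ha⟩ | ⟨a, ha⟩
    · left
      -- The shift is chosen so that `s + 1 + 2m` becomes 1 modulo `n`; for odd `s` it becomes 2.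
      have h1 := h.cocircuit ((n - s) / 2)
      rw [show 2 * ((n - s) / 2) = n - s by omega, Nat.cast_sub (by omega), hn0] at h1
      convert h1 using 3
      ring
    · right
      have h1 := h.cocircuit ((n + 1 - s) / 2)
      rw [show 2 * ((n + 1 - s) / 2) = n + 1 - s by omega, Nat.cast_sub (by omega), Nat.cast_add,
        hn0] at h1
      convert h1 using 3
      push_cast
      ring
  · simp only [isCircuitOfSize_iff he (show s ≤ n by omega)]
    intro hi
    rcases Nat.even_or_odd (i - 1).val with ⟨a, ha⟩ | ⟨a, ha⟩
    · have h1 := h.circuit (a + 1)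
      have h2 : i = 1 + ((a + a : ℕ) : ZMod n) := by rw [← ha, hval]; ring
      convert h1 using 3
      rw [h2]
      push_cast
      ring
    · refine absurd ?_ (not_isCocircuit_of_isCircuit he hs ht hst i hi)
      have h2 : i = 1 + ((2 * a + 1 : ℕ) : ZMod n) := by rw [← ha, hval]; ring
      convert h.cocircuit a using 3
      rw [h2, Nat.cast_sub hs]
      push_cast
      ring
  · simp only [isCocircuitOfSize_iff he (show t ≤ n by omega)]
    intro hj
    rcases Nat.even_or_odd (j - s - 1).val with ⟨a, ha⟩ | ⟨a, ha⟩
    · have h1 := h.cocircuit (a + 1)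
      have h2 : j = s + 1 + ((a + a : ℕ) : ZMod n) := by rw [← ha, hval]; ring
      convert h1 using 3
      rw [h2]
      push_cast
      ring
    · refine absurd ?_ (not_isCircuit_of_isCocircuit he hs ht hst j hj)
      have h2 : j = s + 1 + ((2 * a + 1 : ℕ) : ZMod n) := by rw [← ha, hval]; ring
      convert h.circuit (a + q) using 3
      have h3 : ((2 * (a + q) : ℕ) : ZMod n) = ((2 * a + (s + t) : ℕ) : ZMod n) := by
        congr 1; omega
      rw [h2, h3, Nat.cast_sub ht]
      push_cast
      ring

theorem IsArcCyclic.two_mul_ncard_le (h : IsArcCyclic M s t e) (hs : 1 ≤ s) (ht : 1 ≤ t)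
    (hn : Even n) (hpar : Even (s + t)) (hst : s + t ≤ n) {I : Set α} (hI : M.Indep I) :
    2 * I.ncard + t ≤ n + s := by
  have h1 := h.cocircuit 0
  refine ncard_le_of_isCocircuit h.bijOn hs ht hst (by rw [add_assoc]; exact hn.add hpar) _ h1
    (fun m => ?_) hI
  obtain ⟨q, hq⟩ := hpar
  -- The complement of the cocircuit arc starts at `1 + (s + t)`, a circuit position because `s + t
  -- = 2q`.
  convert h.circuit (q + m) using 3
  have h3 : ((2 * (q + m) : ℕ) : ZMod n) = ((s + t + 2 * m : ℕ) : ZMod n) := by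
    congr 1; omega
  rw [h3]
  push_cast
  ring

/-- The rank bounds for `M` and `M✶` add up to `n`, so both are equalities. -/
theorem IsArcCyclic.two_mul_ncard_base (h : IsArcCyclic M s t e) (hs : 1 ≤ s) (ht : 1 ≤ t)
    (hn : Even n) (hpar : Even (s + t)) (hst : s + t ≤ n) {B : Set α} (hB : M.IsBase B) :
    2 * B.ncard + t = n + s := by
  have h1 := h.two_mul_ncard_le hs ht hn hpar hst hB.indep
  have hK : M✶.IsCocircuit (e '' arc 1 s) := by simpa using h.circuit 0
  have h2 := ncard_le_of_isCocircuit (M := M✶) h.bijOn ht hs (by omega)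
    (by rw [add_assoc, add_comm t]; exact hn.add hpar) 1 hK
    (fun m => by simpa [add_comm (1 : ZMod n)] using h.cocircuit m) hB.compl_isBase_dual.indep
  have hfin : M.E.Finite := h.bijOn.image_eq ▸ toFinite _
  have h3 := ncard_sdiff_add_ncard_of_subset hB.subset_ground hfin
  have h4 : M.E.ncard = n := by
    rw [← h.bijOn.image_eq, ncard_image_of_injective _ (injOn_univ.1 h.bijOn.injOn), ncard_univ,
      Nat.card_zmod]
  omega

/-- Hall's condition asks that the union `X` of the chosen `N i` keep at least `J.card` elements
outside `I`, that is, that the nullity bound hold for `X ∩ I`. -/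
theorem IsArcCyclic.Psi_indep (h : IsArcCyclic M s t e) (hs : 1 ≤ s) (hle : s ≤ t)
    (hn : Even n) (hpar : Even (s + t)) (hst : s + t ≤ n) {I : Set (ZMod n)}
    (hI : M.Indep (e '' I)) : (Psi n s).Indep I := by
  classical
  have hinj := injOn_univ.1 h.bijOn.injOn
  rw [Psi_indep_iff hs]
  let N : Fin (n / 2) → Set (ZMod n) := fun i => arc ((2 * (i : ℕ) + 1 : ℕ) : ZMod n) s
  have hall := (Finset.all_card_le_biUnion_card_iff_exists_injective
    (fun i => (N i \ I).toFinset)).1 ?_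
  · simpa [N] using hall
  intro J
  set X : Set (ZMod n) := ⋃ i ∈ J, N i with hX
  have hXI : (J.biUnion fun i => (N i \ I).toFinset).card = (X \ I).ncard := by
    rw [← ncard_coe_finset]
    congr 1
    ext x
    simp only [hX, Finset.coe_biUnion, coe_toFinset, mem_iUnion, Finset.mem_coe, mem_sdiff,
      exists_prop]
    exact ⟨fun ⟨i, hi, hx, hxI⟩ => ⟨⟨i, hi, hx⟩, hxI⟩, fun ⟨⟨i, hi, hx⟩, hxI⟩ => ⟨i, hi, hx, hxI⟩⟩
  rw [hXI]
  have hadd := ncard_sdiff_add_ncard_of_subset (inter_subset_left (s := X) (t := I)) (toFinite X)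
  rw [sdiff_self_inter] at hadd
  suffices hsuff : (X ∩ I).ncard + J.card ≤ X.ncard by omega
  by_cases hXu : X = univ
  -- With no point at which to cut the cycle, the circuit count is unavailable; `s ≤ t` gives `|I| ≤
  -- n / 2`, and `|J| ≤ n / 2`.
  · have h1 := h.two_mul_ncard_le hs (by omega) hn hpar hst hI
    rw [ncard_image_of_injective _ hinj] at h1
    have h2 : J.card ≤ n / 2 := by simpa using J.card_le_univ
    rw [hXu, univ_inter, ncard_univ, Nat.card_zmod]
    omega
  · obtain ⟨x, hx⟩ := (ne_univ_iff_exists_notMem X).1 hXu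
    -- Cut the cycle at a point `x` outside `X`. An arc with `k i + s > n` would contain `x`, so
    -- none wraps past the cut.
    let k : Fin (n / 2) → ℕ := fun i => (((2 * (i : ℕ) + 1 : ℕ) : ZMod n) - (x + 1)).val
    have hk : ∀ i, x + 1 + (k i : ZMod n) = ((2 * (i : ℕ) + 1 : ℕ) : ZMod n) :=
      fun i => by simp only [k, ZMod.natCast_zmod_val, add_sub_cancel]
    have hNX : ∀ i ∈ J, N i ⊆ X := fun i hi => subset_biUnion_of_mem (u := N) hi
    have h1 := ncard_add_card_le_of_isCircuit_arc h.bijOn hs (X := X)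
      (hI.subset (image_mono (inter_subset_right (s := X)))) (image_mono inter_subset_left) J (x + 1)
      k ?_ ?_ ?_ ?_
    · rwa [ncard_image_of_injective _ hinj] at h1
    · intro i _ j _ hij
      refine natCast_two_mul_add_one_injective (n := n) ?_
      exact (hk i).symm.trans ((congrArg (fun m : ℕ => x + 1 + (m : ZMod n)) hij).trans (hk j))
    · intro i hi
      by_contra hcon
      have hlt : k i < n := ZMod.val_lt _
      have h2 : x = ((2 * (i : ℕ) + 1 : ℕ) : ZMod n) + ((n - 1 - k i : ℕ) : ZMod n) := by
        rw [← hk i, Nat.sub_sub, Nat.cast_sub (by omega)]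
        push_cast
        simp only [CharP.cast_eq_zero]
        ring
      have h3 := add_natCast_mem_arc ((2 * (i : ℕ) + 1 : ℕ) : ZMod n)
        (show n - 1 - k i < s by omega)
      rw [← h2] at h3
      exact hx (hNX i hi h3)
    · intro i _
      rw [hk i]
      convert h.circuit i using 3
      push_cast
      ring
    · intro i hi
      rw [hk i]
      exact hNX i hi

/-- The arc is one of the sets of the presentation, which would have no representative outside it;
`m` is reduced modulo `n / 2` to find its index. -/
theorem not_Psi_indep_arc (hs : 1 ≤ s) (hn : Even n) (m : ℕ) :
    ¬ (Psi n s).Indep (arc (1 + ((2 * m : ℕ) : ZMod n)) s) := by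
  rw [Psi_indep_iff hs]
  rintro ⟨f, -, hf⟩
  obtain ⟨p, hp⟩ := hn
  have hpos : 0 < n / 2 := by have := NeZero.pos n; omega
  have h := hf ⟨m % (n / 2), Nat.mod_lt _ hpos⟩
  refine h.2 ?_
  convert h.1 using 2
  have h1 : 2 * m = 2 * (m % (n / 2)) + n * (m / (n / 2)) := by
    have h2 := Nat.mod_add_div m (n / 2)
    have h3 : n = 2 * (n / 2) := by omega
    calc 2 * m = 2 * (m % (n / 2)) + 2 * (n / 2) * (m / (n / 2)) := by rw [mul_assoc]; omega
      _ = _ := by rw [← h3]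
  rw [h1]
  push_cast
  simp only [CharP.cast_eq_zero]
  ring

end normalForm

/-! ### The truncations of `Ψ^n_s` -/

section main

variable {α : Type*} {M : Matroid α} {n s t : ℕ} [NeZero n] {e : ZMod n → α}

theorem eRank_Psi_eq (hs : 1 ≤ s) (hle : s ≤ t) (hn : Even n) (hpar : Even (s + t))
    (hst : s + t ≤ n) : (Psi n s).eRank = ((n + s - t) / 2 + (t - s) / 2 : ℕ) := by
  rw [eRank_Psi hs hn]
  obtain ⟨p, hp⟩ := hn
  obtain ⟨q, hq⟩ := hpar
  congr 1
  omega

theorem IsArcCyclic.iterTruncation_Psi_indep (h : IsArcCyclic M s t e) (hs : 1 ≤ s) (hle : s ≤ t)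
    (hn : Even n) (hpar : Even (s + t)) (hst : s + t ≤ n) {I : Set (ZMod n)}
    (hI : M.Indep (e '' I)) : (iterTruncation ((t - s) / 2) (Psi n s)).Indep I := by
  rw [iterTruncation_indep_iff (eRank_Psi_eq hs hle hn hpar hst)]
  refine ⟨h.Psi_indep hs hle hn hpar hst hI, ?_⟩
  have h1 := h.two_mul_ncard_le hs (by omega) hn hpar hst hI
  rw [ncard_image_of_injective _ (injOn_univ.1 h.bijOn.injOn)] at h1
  rw [← (toFinite I).cast_ncard_eq]
  exact_mod_cast (show I.ncard ≤ (n + s - t) / 2 by omega)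

/-- Dependence is checked in the truncation itself, while independence of the sets with one element
removed comes from `M` through the weak map. -/
theorem IsArcCyclic.iterTruncation_Psi (h : IsArcCyclic M s t e) (hs : 1 ≤ s) (hle : s ≤ t)
    (hn : Even n) (hpar : Even (s + t)) (hst : s + t ≤ n) :
    IsArcCyclic (iterTruncation ((t - s) / 2) (Psi n s)) s t fun x => x := by
  set N := iterTruncation ((t - s) / 2) (Psi n s) with hN
  have hinj := injOn_univ.1 h.bijOn.injOn
  have hNE : N.E = univ := by rw [hN, iterTruncation_ground, Psi_ground]
  have hbij : BijOn (fun x : ZMod n => x) univ N.E := by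
    rw [hNE]
    exact bijOn_id univ
  have hweak : ∀ {I}, M.Indep (e '' I) → N.Indep I :=
    h.iterTruncation_Psi_indep hs hle hn hpar hst
  have hrank : N.eRank = ((n + s - t) / 2 : ℕ) :=
    eRank_iterTruncation (eRank_Psi_eq hs hle hn hpar hst)
  have hC : ∀ m : ℕ, N.IsCircuit ((fun x => x) '' arc (1 + ((2 * m : ℕ) : ZMod n)) s) := by
    intro m
    rw [image_id', Matroid.isCircuit_iff_dep_forall_sdiff_singleton_indep]
    refine ⟨⟨fun hi => not_Psi_indep_arc hs hn m ?_, by simp [hNE]⟩, fun x hx => hweak ?_⟩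
    · exact ((iterTruncation_indep_iff (eRank_Psi_eq hs hle hn hpar hst)).1 hi).1
    · rw [image_sdiff hinj, image_singleton]
      exact (h.circuit m).sdiff_singleton_indep (mem_image_of_mem e hx)
  refine ⟨hbij, hC, fun m => ?_⟩
  rw [image_id', Matroid.isCocircuit_def,
    Matroid.isCircuit_iff_dep_forall_sdiff_singleton_indep]
  set K := arc ((s : ZMod n) + 1 + ((2 * m : ℕ) : ZMod n)) t with hK
  refine ⟨⟨?_, by simp [hNE]⟩, fun x hx => ?_⟩
  · rw [Matroid.dual_indep_iff_exists (by simp [hNE])]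
    rintro ⟨B, hB, hdisj⟩
    obtain ⟨q, hq⟩ := hpar
    have hBK : B ⊆ Kᶜ := subset_compl_iff_disjoint_left.2 hdisj
    rw [hK, compl_arc _ (by omega)] at hBK
    -- A base avoiding `K` would lie in the complementary arc, whose circuits keep its independent
    -- sets below the rank.
    have h1 := ncard_of_subset_compl_cocircuit (t := t) hbij hs hst
      ((s : ZMod n) + 1 + ((2 * m : ℕ) : ZMod n) + (t : ZMod n)) (fun m' => ?_) hB.indep
      (by rwa [image_id'])
    · have h2 := hB.encard_eq_eRank
      rw [hrank, ← (toFinite B).cast_ncard_eq] at h2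
      have h3 : B.ncard = (n + s - t) / 2 := by exact_mod_cast h2
      obtain ⟨p, hp⟩ := hn
      omega
    · convert hC (q + m + m') using 3
      have h3 : ((2 * (q + m + m') : ℕ) : ZMod n) = ((s + t + 2 * m + 2 * m' : ℕ) : ZMod n) := by
        congr 1; omega
      rw [h3]
      push_cast
      ring
  · rw [Matroid.dual_indep_iff_exists (by simp [hNE])]
    have h1 : M✶.Indep (e '' K \ {e x}) :=
      (h.cocircuit m).isCircuit.sdiff_singleton_indep (mem_image_of_mem e hx)
    rw [Matroid.dual_indep_iff_exists'] at h1
    obtain ⟨-, B, hB, hdisj⟩ := h1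
    have hBE : e '' (e ⁻¹' B) = B := by
      rw [image_preimage_eq_iff, ← image_univ, h.bijOn.image_eq]
      exact hB.subset_ground
    have hBN : N.Indep (e ⁻¹' B) := hweak (by rw [hBE]; exact hB.indep)
    -- The two matroids have equal rank, so a base of `M` pulls back to an independent set of full
    -- size, hence to a base.
    refine ⟨e ⁻¹' B, hBN.isBase_of_eRk_ge (toFinite _) ?_, ?_⟩
    · rw [hBN.eRk_eq_encard, hrank, ← (toFinite (e ⁻¹' B)).cast_ncard_eq]
      have h2 := h.two_mul_ncard_base hs (by omega) hn hpar hst hB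
      rw [← hBE, ncard_image_of_injective _ hinj] at h2
      exact_mod_cast (show (n + s - t) / 2 ≤ (e ⁻¹' B).ncard by omega)
    · rw [disjoint_left] at hdisj ⊢
      rintro y ⟨hyK, hyx⟩ hyB
      exact hdisj ⟨mem_image_of_mem e hyK, fun h => hyx (hinj h)⟩ hyB

end main

end CyclicMatroid

theorem theorem1p3 {α : Type*} (M : Matroid α) (n s t : ℕ) [NeZero n] (hs : 2 ≤ s) (hst : s ≤ t)
    (hn : s + t - 1 ≤ n) (hcard : M.E.ncard = n) (hM : CyclicMatroid.IsCyclic M s t) :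
    Even n ∧ s ≡ t [MOD 2] ∧
      CyclicMatroid.IsCyclic (CyclicMatroid.iterTruncation ((t - s) / 2) (CyclicMatroid.Psi n s))
        s t ∧
      CyclicMatroid.IsWeakMapImage M
        (CyclicMatroid.iterTruncation ((t - s) / 2) (CyclicMatroid.Psi n s)) := by
  obtain ⟨n', hn', e, he⟩ := hM
  obtain rfl : n' = n := by
    have : NeZero n' := ⟨hn'.ne'⟩
    rw [← hcard, ← he.bijOn.image_eq, ncard_image_of_injective _ (injOn_univ.1 he.bijOn.injOn),
      ncard_univ, Nat.card_zmod]
  obtain ⟨heven, hpar, e', h⟩ := he.exists_isArcCyclic (by omega) (by omega) (by omega)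
  -- Parity excludes `s + t = n' + 1`.
  have hle : s + t ≤ n' := by
    rcases heven with ⟨p, hp⟩
    rcases hpar with ⟨q, hq⟩
    omega
  have hΨE : (CyclicMatroid.iterTruncation ((t - s) / 2) (CyclicMatroid.Psi n' s)).E = univ := by
    rw [CyclicMatroid.iterTruncation_ground, CyclicMatroid.Psi_ground]
  refine ⟨heven, ?_, ?_, e', ?_, fun I hI => ?_⟩
  · rcases hpar with ⟨q, hq⟩
    unfold Nat.ModEq
    omega
  · exact (h.iterTruncation_Psi (by omega) hst heven hpar hle).isCyclic (by omega) (by omega)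
      heven hpar (by omega)
  · rw [hΨE]
    exact h.bijOn
  · rw [hΨE, inter_univ]
    exact h.iterTruncation_Psi_indep (by omega) hst heven hpar hle
      (hI.subset (image_preimage_subset _ _))
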